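/- Let $K\in\mathbb R$, $N\in(1,\infty)$ and $D\in(0,\infty)$. **Notation.** For $\kappa\in\mathbb R$ let $s_\kappa(\theta)=\frac{1}{\sqrt{\kappa}}\sin(\sqrt{\kappa}\,\theta)$ if $\kappa>0$, $s_0(\theta)=\theta$, and $s_\kappa(\theta)=\frac{1}{\sqrt{-\kappa}}\sinh(\sqrt{-\kappa}\,\theta)$ if $\kappa<0$. Let $D_{K,N}=\pi/\sqrt{K/(N-1)}$ if $K>0$ and $D_{K,N}=+\infty$ if $K\le 0$. For $t\in[0,1]$ and $\theta\ge 0$ let $\sigma^{(t)}_{K,N-1}(\theta)=+\infty$ if $\theta\ge D_{K,N}$ and $\sigma^{(t)}_{K,N-1}(\theta)=s_{K/(N-1)}(t\theta)/s_{K/(N-1)}(\theta)$ otherwise (read as its limit $t$ at $\theta=0$). For a non-negative $h\in L^1_{loc}(\mathbb R,\mathcal L^1)$, write $\operatorname{supp}h$ for the support of the measure $h\mathcal L^1$. Such an $h$ is called an $\mathrm{MCP}(K,N)$ density if $$h(tx_1+(1-t)x_0)\ \ge\ \sigma^{(1-t)}_{K,N-1}(|x_1-x_0|)^{N-1}\,h(x_0)\qquad\text{for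 all }x_0,x_1\in\operatorname{supp}h,\ t\in[0,1]$$ (an inequality in $[0,\infty]$, with $\infty\cdot 0=0$). Its Poincaré constant $\lambda[h]\in[0,\infty]$ is $$\lambda[h]=\inf\left\{\frac{\int_{\mathbb R}|f'|^2h\,dx}{\int_{\mathbb R}|f|^2h\,dx}\ :\ f:\mathbb R\to\mathbb R\text{ locally Lipschitz},\ fh\in L^1,\ \int_{\mathbb R}fh\,dx=0,\ 0<\int_{\mathbb R}|f|^2h\,dx<\infty\right\}.$$ For $D\le D_{K,N}$ the model density $h_{K,N,D}$ is $$h_{K,N,D}(x)=\begin{cases}s_{K/(N-1)}(D-x)^{N-1}&x\in[0,D/2],\\ s_{K/(N-1)}(x)^{N-1}&x\in[D/2,D],\\ 0&x\notin[0,D].\end{cases}$$ **Proposition.** If $h$ is an $\mathrm{MCP}(K,N)$ density with $\operatorname{diam}(\operatorname{supp}h)=D$, then $D\le D_{K,N}$ and $$\lambda[h]\ \ge\ \lambda[h_{K,N,D}].$$ The estimate is sharp: whenever $D\le D_{K,N}$, $h_{K,N,D}$ is itself an $\mathrm{MCP}(K,N)$ density, with $\operatorname{supp}h_{K,N,D}=[0,D]$,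 so that equality is attained. -/

import Mathlib

open MeasureTheory
open scoped ENNReal

noncomputable section

/-- The function `s_κ`: `sin (√κ θ) / √κ` for `κ > 0`, `θ` for `κ = 0`,
`sinh (√(-κ) θ) / √(-κ)` for `κ < 0`. -/
def sFun (κ θ : ℝ) : ℝ :=
  if 0 < κ then (1 / √κ) * Real.sin (√κ * θ)
  else if κ = 0 then θ
  else (1 / √(-κ)) * Real.sinh (√(-κ) * θ)

/-- The Bonnet-Myers diameter bound `D_{K,N} ∈ (0, ∞]`: `π / √(K / (N - 1))` for `K > 0`,
and `∞` otherwise. -/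
def bonnetMyers (K N : ℝ) : ℝ≥0∞ :=
  if 0 < K then ENNReal.ofReal (Real.pi / √(K / (N - 1))) else ⊤

/-- The distortion coefficient `σ_{K,N-1}^{(t)}(θ) ∈ [0, ∞]`, for `t ∈ [0, 1]` and `θ ≥ 0`:
`∞` if `θ ≥ D_{K,N}`, and `s_{K/(N-1)}(t θ) / s_{K/(N-1)}(θ)` otherwise. At `θ = 0`, where the
quotient reads `0 / 0`, it stands for its limit `t`. -/
def sigmaCoeff (K N t θ : ℝ) : ℝ≥0∞ :=
  if bonnetMyers K N ≤ ENNReal.ofReal θ then ⊤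
  else if θ = 0 then ENNReal.ofReal t
  else ENNReal.ofReal (sFun (K / (N - 1)) (t * θ) / sFun (K / (N - 1)) θ)

/-- The measure `h ℒ¹` on `ℝ`, for a non-negative density `h`. -/
def densityMeasure (h : ℝ → ℝ) : Measure ℝ :=
  volume.withDensity fun x => ENNReal.ofReal (h x)

/-- `supp h`, the support of the measure `h ℒ¹`. -/
def densitySupport (h : ℝ → ℝ) : Set ℝ := (densityMeasure h).support

/-- `h` is a (one-dimensional) `MCP(K, N)` density: a non-negative locally integrable function with
`h (t x₁ + (1 - t) x₀) ≥ σ_{K,N-1}^{(1-t)}(|x₁ - x₀|)^{N-1} h (x₀)` for all `x₀, x₁ ∈ supp h` and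
`t ∈ [0, 1]`. The inequality is read in `[0, ∞]`, with `∞ * 0 = 0`. -/
structure IsMCPDensity (K N : ℝ) (h : ℝ → ℝ) : Prop where
  nonneg : ∀ x, 0 ≤ h x
  locallyIntegrable : LocallyIntegrable h volume
  contraction : ∀ x₀ ∈ densitySupport h, ∀ x₁ ∈ densitySupport h, ∀ t ∈ Set.Icc (0 : ℝ) 1,
    sigmaCoeff K N (1 - t) |x₁ - x₀| ^ (N - 1) * ENNReal.ofReal (h x₀)
      ≤ ENNReal.ofReal (h (t * x₁ + (1 - t) * x₀))

/-- Admissible test functions for the Poincaré constant of `h`: locally Lipschitz functions `f` on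
`ℝ` with `∫ f h dx = 0` (the integral being absolutely convergent) and `0 < ∫ f² h dx < ∞`. -/
structure IsPoincareTest (h f : ℝ → ℝ) : Prop where
  locallyLipschitz : LocallyLipschitz f
  integrable : Integrable f (densityMeasure h)
  mean_zero : ∫ x, f x ∂(densityMeasure h) = 0
  sq_pos : 0 < ∫⁻ x, ENNReal.ofReal (f x ^ 2) ∂(densityMeasure h)
  sq_lt_top : ∫⁻ x, ENNReal.ofReal (f x ^ 2) ∂(densityMeasure h) < ∞

/-- The Poincaré constant `λ[h] ∈ [0, ∞]`, the infimum over the admissible `f` of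
`∫ |f'|² h dx / ∫ f² h dx`. A locally Lipschitz `f` is differentiable almost everywhere, so `deriv f`
is the derivative of `f` almost everywhere. -/
def poincareConst (h : ℝ → ℝ) : ℝ≥0∞ :=
  ⨅ (f : ℝ → ℝ) (_ : IsPoincareTest h f),
    (∫⁻ x, ENNReal.ofReal (deriv f x ^ 2) ∂(densityMeasure h)) /
      ∫⁻ x, ENNReal.ofReal (f x ^ 2) ∂(densityMeasure h)

/-- The model density `h_{K,N,D}`: `s_{K/(N-1)}(D - x)^{N-1}` on `[0, D/2]`,
`s_{K/(N-1)}(x)^{N-1}` on `[D/2, D]`, and `0` outside `[0, D]`. It is meant for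
`0 < D ≤ D_{K,N}`. -/
def modelDensity (K N D : ℝ) (x : ℝ) : ℝ :=
  if 0 ≤ x ∧ x ≤ D / 2 then sFun (K / (N - 1)) (D - x) ^ (N - 1)
  else if D / 2 < x ∧ x ≤ D then sFun (K / (N - 1)) x ^ (N - 1)
  else 0

end

/-! Contracting towards an endpoint of the support turns the MCP inequality into a monotonicity
statement. With support `[a, a + D]`, both `h (a + x) / s(x)^(N-1)` and `h (a + D - x) / s(x)^(N-1)`
are nonincreasing on `(0, D)`. On its right half the model is exactly `s(x)^(N-1)`, so each half of
`h`, read outwards from the midpoint, is the model times a nonincreasing factor.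

The model is symmetric, so a function on its right half vanishing at `D / 2` extends oddly to a test
function of mean zero; this gives a half-interval inequality with constant `λ[model]`
(`poincareConst_mul_le_of_eq_zero`). Freezing the function after `t` localises it to `(D / 2, t)`.
Superlevel sets of a nonincreasing factor are such initial segments up to null sets, so the
layer-cake formula transfers the inequality to `h` (`poincareConst_mul_le_of_relative_antitone`).

For a test function `f` of `h`, apply this on both halves to `f` minus its midpoint value and add.
Since `f` has mean zero, subtracting the constant only increases the second moment. -/

/-! ### The functions `s_κ`. -/

section SFun

variable {κ D : ℝ}

lemma sFun_of_pos (hκ : 0 < κ) (x : ℝ) : sFun κ x = (1 / √κ) * Real.sin (√κ * x) := if_pos hκ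

lemma sFun_zero_left (x : ℝ) : sFun 0 x = x := by simp [sFun]

lemma sFun_of_neg (hκ : κ < 0) (x : ℝ) : sFun κ x = (1 / √(-κ)) * Real.sinh (√(-κ) * x) := by
  simp [sFun, hκ.not_gt, hκ.ne]

@[simp] lemma sFun_zero_right : sFun κ 0 = 0 := by simp [sFun]

lemma sFun_neg (x : ℝ) : sFun κ (-x) = -sFun κ x := by
  simp only [sFun]
  split_ifs <;> simp

lemma continuous_sFun : Continuous (sFun κ) := by
  rcases lt_trichotomy κ 0 with h | rfl | h
  · rw [funext (sFun_of_neg h)]; fun_prop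
  · rw [funext sFun_zero_left]; fun_prop
  · rw [funext (sFun_of_pos h)]; fun_prop

/-- The three-point addition formula for `s_κ`. -/
lemma sFun_mul_sub (x y z : ℝ) :
    sFun κ y * sFun κ (x - z) - sFun κ (y - z) * sFun κ x = sFun κ z * sFun κ (x - y) := by
  rcases lt_trichotomy κ 0 with h | rfl | h
  · simp only [sFun_of_neg h, mul_sub, Real.sinh_sub]
    generalize √(-κ) * x = a
    generalize √(-κ) * y = b
    generalize √(-κ) * z = c
    ring
  · simp only [sFun_zero_left]; ring
  · simp only [sFun_of_pos h, mul_sub, Real.sin_sub]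
    generalize √κ * x = a
    generalize √κ * y = b
    generalize √κ * z = c
    ring

lemma sFun_pos {x : ℝ} (hx : 0 < x) (h : 0 < κ → x < Real.pi / √κ) : 0 < sFun κ x := by
  rcases lt_trichotomy κ 0 with hκ | rfl | hκ
  · rw [sFun_of_neg hκ]
    have : 0 < √(-κ) := Real.sqrt_pos.2 (by linarith)
    have := Real.sinh_pos_iff.2 (mul_pos this hx)
    positivity
  · rwa [sFun_zero_left]
  · rw [sFun_of_pos hκ]
    have hs : 0 < √κ := Real.sqrt_pos.2 hκ
    have := Real.sin_pos_of_pos_of_lt_pi (mul_pos hs hx)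
      (by have := (lt_div_iff₀ hs).1 (h hκ); linarith)
    positivity

lemma sFun_nonneg {x : ℝ} (hx : 0 ≤ x) (h : 0 < κ → x ≤ Real.pi / √κ) : 0 ≤ sFun κ x := by
  rcases hx.eq_or_lt with rfl | hx
  · simp
  by_cases hκ : 0 < κ
  · rw [sFun_of_pos hκ]
    have hs : 0 < √κ := Real.sqrt_pos.2 hκ
    have := Real.sin_nonneg_of_nonneg_of_le_pi (mul_pos hs hx).le
      (by have := (le_div_iff₀ hs).1 (h hκ); linarith)
    positivity
  · exact (sFun_pos hx fun h => absurd h hκ).le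

lemma sFun_pi_div_sqrt (hκ : 0 < κ) : sFun κ (Real.pi / √κ) = 0 := by
  have hs : √κ ≠ 0 := (Real.sqrt_pos.2 hκ).ne'
  rw [sFun_of_pos hκ, mul_div_cancel₀ _ hs]
  simp

/-- Decides which branch of `modelRoot` is the larger. For `κ > 0` the difference of sines is twice
a product whose cosine factor has argument `√κ D / 2 ≤ π / 2`. -/
lemma sFun_le_sFun_sub {x : ℝ} (hx : 0 ≤ x) (hxD : x ≤ D / 2)
    (hD : 0 < κ → D ≤ Real.pi / √κ) : sFun κ x ≤ sFun κ (D - x) := by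
  rcases lt_trichotomy κ 0 with hκ | rfl | hκ
  · rw [sFun_of_neg hκ, sFun_of_neg hκ]
    gcongr
    apply Real.sinh_le_sinh.2
    gcongr
    linarith
  · rw [sFun_zero_left, sFun_zero_left]; linarith
  · rw [sFun_of_pos hκ, sFun_of_pos hκ]
    have hs : 0 < √κ := Real.sqrt_pos.2 hκ
    have hDπ : D * √κ ≤ Real.pi := (le_div_iff₀ hs).1 (hD hκ)
    gcongr
    have e := Real.sin_sub_sin (√κ * (D - x)) (√κ * x)
    have h1 : 0 ≤ Real.sin ((√κ * (D - x) - √κ * x) / 2) := by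
      apply Real.sin_nonneg_of_nonneg_of_le_pi
      · nlinarith
      · nlinarith [mul_nonneg hs.le hx, Real.pi_pos]
    have h2 : 0 ≤ Real.cos ((√κ * (D - x) + √κ * x) / 2) := by
      apply Real.cos_nonneg_of_neg_pi_div_two_le_of_le
      · nlinarith [mul_nonneg hs.le (hx.trans hxD), Real.pi_pos]
      · nlinarith
    have := mul_nonneg h1 h2
    linarith

end SFun

/-! ### The model density: symmetry, regularity and support. -/

section Model

variable {K N D : ℝ}

lemma div_sub_one_pos_iff (hN : 1 < N) : 0 < K / (N - 1) ↔ 0 < K :=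
  div_pos_iff_of_pos_right (by linarith)

lemma ofReal_le_bonnetMyers_iff (hN : 1 < N) (x : ℝ) :
    ENNReal.ofReal x ≤ bonnetMyers K N ↔
      (0 < K / (N - 1) → x ≤ Real.pi / √(K / (N - 1))) := by
  rw [div_sub_one_pos_iff hN, bonnetMyers]
  split_ifs with h
  · rw [ENNReal.ofReal_le_ofReal_iff (by positivity)]
    simp [h]
  · simp [h]

lemma bonnetMyers_le_ofReal_iff (hN : 1 < N) {x : ℝ} (hx : 0 ≤ x) :
    bonnetMyers K N ≤ ENNReal.ofReal x ↔
      0 < K / (N - 1) ∧ Real.pi / √(K / (N - 1)) ≤ x := by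
  rw [div_sub_one_pos_iff hN, bonnetMyers]
  split_ifs with h
  · rw [ENNReal.ofReal_le_ofReal_iff hx]
    simp [h]
  · simp [h]

/-- The `(N - 1)`-th root of the model density on `[0, D]`. -/
noncomputable def modelRoot (κ D x : ℝ) : ℝ := max (sFun κ x) (sFun κ (D - x))

lemma modelRoot_symm (κ D x : ℝ) : modelRoot κ D (D - x) = modelRoot κ D x := by
  simp [modelRoot, max_comm]

lemma modelRoot_nonneg {κ x : ℝ} (hD : 0 < κ → D ≤ Real.pi / √κ) (hx : x ∈ Set.Icc 0 D) :
    0 ≤ modelRoot κ D x :=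
  le_max_of_le_left (sFun_nonneg hx.1 fun h => hx.2.trans (hD h))

lemma modelRoot_eq_of_half_le {κ x : ℝ} (hD : 0 < κ → D ≤ Real.pi / √κ)
    (hx : D / 2 ≤ x) (hxD : x ≤ D) : modelRoot κ D x = sFun κ x := by
  refine max_eq_left ?_
  have := sFun_le_sFun_sub (x := D - x) (by linarith) (by linarith) hD
  rwa [sub_sub_cancel] at this

lemma continuous_modelRoot (κ D : ℝ) : Continuous (modelRoot κ D) :=
  continuous_sFun.max (continuous_sFun.comp (by fun_prop))

/-- In this form symmetry and continuity on `[0, D]` are immediate, and the contraction inequality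
can be checked on each branch of the maximum separately. -/
lemma modelDensity_eq_indicator (hDK : 0 < K / (N - 1) → D ≤ Real.pi / √(K / (N - 1))) :
    modelDensity K N D =
      (Set.Icc 0 D).indicator fun x => modelRoot (K / (N - 1)) D x ^ (N - 1) := by
  ext x
  simp only [modelDensity, Set.indicator, Set.mem_Icc]
  by_cases h1 : 0 ≤ x ∧ x ≤ D / 2
  · rw [if_pos h1, if_pos ⟨h1.1, by linarith⟩, modelRoot,
      max_eq_right (sFun_le_sFun_sub h1.1 h1.2 hDK)]
  rw [if_neg h1]
  by_cases h2 : D / 2 < x ∧ x ≤ D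
  · rw [if_pos h2, if_pos ⟨by linarith, h2.2⟩, modelRoot_eq_of_half_le hDK h2.1.le h2.2]
  · rw [if_neg h2, if_neg]
    rintro ⟨h3, h4⟩
    rcases le_or_gt x (D / 2) with h5 | h5
    · exact h1 ⟨h3, h5⟩
    · exact h2 ⟨h5, h4⟩

lemma modelDensity_symm (hDK : 0 < K / (N - 1) → D ≤ Real.pi / √(K / (N - 1))) (x : ℝ) :
    modelDensity K N D (D - x) = modelDensity K N D x := by
  simp only [modelDensity_eq_indicator hDK, Set.indicator, modelRoot_symm, Set.mem_Icc]
  congr 1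
  simp [and_comm]

lemma modelDensity_of_mem_Ioo {x : ℝ} (hx : x ∈ Set.Ioo (D / 2) D) :
    modelDensity K N D x = sFun (K / (N - 1)) x ^ (N - 1) := by
  rw [modelDensity, if_neg (fun h => hx.1.not_ge h.2), if_pos ⟨hx.1, hx.2.le⟩]

lemma continuous_modelRoot_rpow (hN : 1 < N) (κ : ℝ) :
    Continuous fun x => modelRoot κ D x ^ (N - 1) :=
  (continuous_modelRoot κ D).rpow_const fun _ => Or.inr (by linarith)

lemma measurable_modelDensity (hN : 1 < N)
    (hDK : 0 < K / (N - 1) → D ≤ Real.pi / √(K / (N - 1))) :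
    Measurable (modelDensity K N D) := by
  rw [modelDensity_eq_indicator hDK]
  exact (continuous_modelRoot_rpow hN _).measurable.indicator measurableSet_Icc

lemma modelDensity_nonneg (hDK : 0 < K / (N - 1) → D ≤ Real.pi / √(K / (N - 1))) (x : ℝ) :
    0 ≤ modelDensity K N D x := by
  rw [modelDensity_eq_indicator hDK]
  exact Set.indicator_nonneg (fun x hx => Real.rpow_nonneg (modelRoot_nonneg hDK hx) _) x

lemma integrable_mul_modelDensity (hN : 1 < N)
    (hDK : 0 < K / (N - 1) → D ≤ Real.pi / √(K / (N - 1))) {f : ℝ → ℝ} (hf : Continuous f) :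
    Integrable (fun x => modelDensity K N D x * f x) := by
  rw [modelDensity_eq_indicator hDK]
  simp_rw [← Set.indicator_mul_left]
  rw [integrable_indicator_iff measurableSet_Icc]
  exact ((continuous_modelRoot_rpow hN _).mul hf).continuousOn.integrableOn_compact isCompact_Icc

lemma modelDensity_pos (hDK : 0 < K / (N - 1) → D ≤ Real.pi / √(K / (N - 1))) {x : ℝ}
    (hx : x ∈ Set.Ioo 0 D) : 0 < modelDensity K N D x := by
  rw [modelDensity_eq_indicator hDK, Set.indicator_of_mem (Set.Ioo_subset_Icc_self hx)]
  exact Real.rpow_pos_of_pos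
    (lt_max_of_lt_left (sFun_pos hx.1 fun h => hx.2.trans_le (hDK h))) _

/-- An interval on which the density is positive lies in its support. -/
lemma Icc_subset_densitySupport {h : ℝ → ℝ} (hm : AEMeasurable h) {a b : ℝ} (hab : a < b)
    (hpos : ∀ x ∈ Set.Ioo a b, 0 < h x) : Set.Icc a b ⊆ densitySupport h := by
  rw [densitySupport, ← closure_Ioo hab.ne, Measure.isClosed_support.closure_subset_iff]
  intro x hx
  rw [Measure.mem_support_iff_forall]
  intro U hU
  have hV : U ∩ Set.Ioo a b ∈ nhds x := Filter.inter_mem hU (Ioo_mem_nhds hx.1 hx.2)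
  obtain ⟨W, hWU, hWo, hxW⟩ := mem_nhds_iff.1 hV
  refine lt_of_lt_of_le ?_ (measure_mono (hWU.trans Set.inter_subset_left))
  rw [pos_iff_ne_zero, densityMeasure, Ne,
    withDensity_apply_eq_zero' (by fun_prop)]
  have : {x | ENNReal.ofReal (h x) ≠ 0} ∩ W = W := by
    apply Set.inter_eq_right.2
    intro y hy
    simpa using hpos y (hWU hy).2
  rw [this]
  exact (hWo.measure_pos volume ⟨x, hxW⟩).ne'

lemma densitySupport_modelDensity (hN : 1 < N) (hD : 0 < D)
    (hDK : 0 < K / (N - 1) → D ≤ Real.pi / √(K / (N - 1))) :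
    densitySupport (modelDensity K N D) = Set.Icc 0 D := by
  apply Set.Subset.antisymm
  · apply Measure.support_subset_of_isClosed isClosed_Icc
    rw [mem_ae_iff, densityMeasure,
      withDensity_apply_eq_zero' (measurable_modelDensity hN hDK).ennreal_ofReal.aemeasurable]
    convert measure_empty (μ := volume)
    ext x
    simp only [modelDensity_eq_indicator hDK]
    by_cases hx : x ∈ Set.Icc 0 D <;> simp [hx, -Set.mem_Icc]
  · exact Icc_subset_densitySupport (measurable_modelDensity hN hDK).aemeasurable hD
      fun x hx => modelDensity_pos hDK hx

/-- Each branch satisfies the inequality by itself: by `sFun_mul_sub` the defects, after clearing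
the denominator, are `s(x₁) s(x₀ - y)` and `s(D - x₁) s(x₀ - y)`, both nonnegative. -/
lemma sFun_div_mul_modelRoot_le {κ x₀ x₁ y : ℝ} (hD : 0 < κ → D ≤ Real.pi / √κ)
    (h₁ : 0 ≤ x₁) (h₂ : x₁ ≤ y) (h₃ : y ≤ x₀) (h₄ : x₀ ≤ D) (hpos : 0 < sFun κ (x₀ - x₁)) :
    sFun κ (y - x₁) / sFun κ (x₀ - x₁) * modelRoot κ D x₀ ≤ modelRoot κ D y := by
  rw [div_mul_eq_mul_div, div_le_iff₀ hpos, modelRoot, modelRoot]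
  have hy : 0 ≤ sFun κ (y - x₁) := sFun_nonneg (by linarith) fun h => by linarith [hD h]
  have hxy : 0 ≤ sFun κ (x₀ - y) := sFun_nonneg (by linarith) fun h => by linarith [hD h]
  rw [mul_max_of_nonneg _ _ hy, max_mul_of_nonneg _ _ hpos.le]
  have e1 := sFun_mul_sub (κ := κ) x₀ y x₁
  have e2 := sFun_mul_sub (κ := κ) (D - y) (D - x₀) (D - x₁)
  rw [show D - y - (D - x₁) = -(y - x₁) by ring, show D - x₀ - (D - x₁) = -(x₀ - x₁) by ring,
    show D - y - (D - x₀) = x₀ - y by ring, sFun_neg, sFun_neg] at e2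
  apply max_le_max
  · have : 0 ≤ sFun κ x₁ := sFun_nonneg (by linarith) fun h => by linarith [hD h]
    nlinarith [mul_nonneg this hxy]
  · have : 0 ≤ sFun κ (D - x₁) := sFun_nonneg (by linarith) fun h => by linarith [hD h]
    nlinarith [mul_nonneg this hxy]

end Model

/-! ### The model is an MCP density. -/

section ModelMCP

variable {K N D : ℝ}

lemma sFun_div_mul_modelRoot_segment_le {κ x₀ x₁ t : ℝ} (hD : 0 < κ → D ≤ Real.pi / √κ)
    (h₀ : x₀ ∈ Set.Icc 0 D) (h₁ : x₁ ∈ Set.Icc 0 D) (ht : t ∈ Set.Icc (0 : ℝ) 1)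
    (hpos : 0 < sFun κ |x₁ - x₀|) :
    sFun κ ((1 - t) * |x₁ - x₀|) / sFun κ |x₁ - x₀| * modelRoot κ D x₀
      ≤ modelRoot κ D (t * x₁ + (1 - t) * x₀) := by
  obtain ⟨h₀, h₀'⟩ := h₀
  obtain ⟨h₁, h₁'⟩ := h₁
  obtain ⟨ht, ht'⟩ := ht
  rcases le_total x₁ x₀ with h | h
  · rw [abs_of_nonpos (by linarith), neg_sub] at *
    convert sFun_div_mul_modelRoot_le (y := t * x₁ + (1 - t) * x₀) hD h₁ (by nlinarith)
      (by nlinarith) h₀' hpos using 4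
    ring
  · rw [abs_of_nonneg (by linarith)] at *
    -- The reflection `x ↦ D - x` reduces to a contraction towards the left.
    rw [← modelRoot_symm κ D x₀, ← modelRoot_symm κ D (t * x₁ + (1 - t) * x₀)]
    convert sFun_div_mul_modelRoot_le (x₀ := D - x₀) (x₁ := D - x₁)
      (y := D - (t * x₁ + (1 - t) * x₀)) hD (by linarith) (by nlinarith)
      (by nlinarith) (by linarith) (by convert hpos using 2; ring) using 4
    · ring
    · ring

lemma isMCPDensity_modelDensity (hN : 1 < N) (hD : 0 < D)
    (hDK : 0 < K / (N - 1) → D ≤ Real.pi / √(K / (N - 1))) :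
    IsMCPDensity K N (modelDensity K N D) where
  nonneg := modelDensity_nonneg hDK
  locallyIntegrable := by
    simpa using (integrable_mul_modelDensity hN hDK (f := fun _ => 1)
      continuous_const).locallyIntegrable
  contraction := by
    rw [densitySupport_modelDensity hN hD hDK]
    intro x₀ h₀ x₁ h₁ t ht
    have hy : t * x₁ + (1 - t) * x₀ ∈ Set.Icc 0 D :=
      (convex_Icc 0 D) h₁ h₀ ht.1 (by linarith [ht.2]) (by ring)
    have hθ : |x₁ - x₀| ≤ D := by
      rw [abs_le]; constructor <;> linarith [h₀.1, h₀.2, h₁.1, h₁.2]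
    rw [sigmaCoeff]
    split_ifs with hB h0
    -- An infinite coefficient forces `D = π / √κ` and the two points to be opposite endpoints; the
    -- model vanishes there, so the left side is `∞ * 0 = 0`.
    · obtain ⟨hκ, hle⟩ := (bonnetMyers_le_ofReal_iff hN (abs_nonneg _)).1 hB
      have hDeq : D = Real.pi / √(K / (N - 1)) := le_antisymm (hDK hκ) (hle.trans hθ)
      have hsD : sFun (K / (N - 1)) D = 0 := by rw [hDeq, sFun_pi_div_sqrt hκ]
      have hθD : |x₁ - x₀| = D := le_antisymm hθ (hDeq ▸ hle)
      have hx₀ : x₀ = 0 ∨ x₀ = D := by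
        rcases abs_eq hD.le |>.1 hθD with h | h
        · left; linarith [h₀.1, h₁.2]
        · right; linarith [h₀.2, h₁.1]
      have hm : modelDensity K N D x₀ = 0 := by
        rw [modelDensity_eq_indicator hDK, Set.indicator_of_mem h₀]
        have : modelRoot (K / (N - 1)) D x₀ = 0 := by
          rcases hx₀ with rfl | rfl <;> simp [modelRoot, hsD]
        rw [this, Real.zero_rpow (by linarith)]
      simp [hm]
    · have hx : x₁ = x₀ := by rwa [abs_eq_zero, sub_eq_zero] at h0
      subst hx
      rw [show t * x₁ + (1 - t) * x₁ = x₁ by ring]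
      refine mul_le_of_le_one_left zero_le (ENNReal.rpow_le_one ?_ (by linarith))
      rw [ENNReal.ofReal_le_one]
      linarith [ht.1]
    · have hθ0 : 0 < |x₁ - x₀| := lt_of_le_of_ne (abs_nonneg _) (Ne.symm h0)
      have hθB : 0 < K / (N - 1) → |x₁ - x₀| < Real.pi / √(K / (N - 1)) := by
        intro hκ
        by_contra! hcon
        exact hB ((bonnetMyers_le_ofReal_iff hN (abs_nonneg _)).2 ⟨hκ, hcon⟩)
      have hpos := sFun_pos hθ0 hθB
      have hnum : 0 ≤ sFun (K / (N - 1)) ((1 - t) * |x₁ - x₀|) :=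
        sFun_nonneg (mul_nonneg (by linarith [ht.2]) hθ0.le)
          fun hκ => by nlinarith [ht.1, hθB hκ]
      have hq := div_nonneg hnum hpos.le
      have hle := sFun_div_mul_modelRoot_segment_le hDK h₀ h₁ ht hpos
      rw [modelDensity_eq_indicator hDK, Set.indicator_of_mem h₀, Set.indicator_of_mem hy,
        ENNReal.ofReal_rpow_of_nonneg hq (by linarith),
        ← ENNReal.ofReal_mul (Real.rpow_nonneg hq _),
        ← Real.mul_rpow hq (modelRoot_nonneg hDK h₀)]
      exact ENNReal.ofReal_le_ofReal (Real.rpow_le_rpow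
        (mul_nonneg hq (modelRoot_nonneg hDK h₀)) hle (by linarith))

end ModelMCP

/-! ### From the spectral gap to a half-interval inequality. -/

section HalfInequality

variable {K N D : ℝ}

lemma lintegral_densityMeasure {h : ℝ → ℝ} (hm : AEMeasurable h) {F : ℝ → ℝ≥0∞}
    (hF : Measurable F) :
    ∫⁻ x, F x ∂(densityMeasure h) = ∫⁻ x, ENNReal.ofReal (h x) * F x := by
  rw [densityMeasure, lintegral_withDensity_eq_lintegral_mul₀ hm.ennreal_ofReal hF.aemeasurable]
  rfl

/-- Extension of `g`, restricted to `[c, ∞)`, to a function antisymmetric about `c`,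
provided `g c = 0`. -/
noncomputable def oddExtension (c : ℝ) (g : ℝ → ℝ) (x : ℝ) : ℝ :=
  g (max x c) - g (max (2 * c - x) c)

variable {c : ℝ} {g : ℝ → ℝ}

lemma LocallyLipschitz.oddExtension (hg : LocallyLipschitz g) :
    LocallyLipschitz (oddExtension c g) := by
  have h1 : LocallyLipschitz fun x : ℝ => max x c := LocallyLipschitz.id.max_const c
  have h2 : LocallyLipschitz fun x : ℝ => max (2 * c - x) c :=
    ((LocallyLipschitz.const (2 * c)).sub LocallyLipschitz.id).max_const c
  exact (hg.comp h1).sub (hg.comp h2)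

lemma oddExtension_symm (x : ℝ) : oddExtension c g (2 * c - x) = -oddExtension c g x := by
  simp [oddExtension]

lemma oddExtension_of_lt (hc : g c = 0) {x : ℝ} (hx : c < x) : oddExtension c g x = g x := by
  rw [oddExtension, max_eq_left hx.le, max_eq_right (by linarith), hc, sub_zero]

lemma deriv_oddExtension_of_lt (hc : g c = 0) {x : ℝ} (hx : c < x) :
    deriv (oddExtension c g) x = deriv g x := by
  apply Filter.EventuallyEq.deriv_eq
  filter_upwards [lt_mem_nhds hx] with y hy using oddExtension_of_lt hc hy

lemma deriv_oddExtension_symm (x : ℝ) :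
    deriv (oddExtension c g) (2 * c - x) = deriv (oddExtension c g) x := by
  have h : (fun x => oddExtension c g (2 * c - x)) = fun x => -oddExtension c g x :=
    funext oddExtension_symm
  have h2 := congrArg (fun F => deriv F x) h
  simp only [deriv.fun_neg, deriv_comp_const_sub] at h2
  linarith

/-- The integral of a function symmetric about `c` is twice its integral over `(c, ∞)`. -/
lemma lintegral_eq_two_mul_of_symm {F : ℝ → ℝ≥0∞}
    (hs : ∀ x, F (2 * c - x) = F x) : ∫⁻ x, F x = 2 * ∫⁻ x in Set.Ioi c, F x := by
  have h := lintegral_add_compl (μ := volume) F (measurableSet_Ioi (a := c))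
  rw [← h, two_mul]
  congr 1
  have h1 : ∫⁻ x in (Set.Ioi c)ᶜ, F x = ∫⁻ x in Set.Iio c, F x := by
    rw [Set.compl_Ioi]; exact setLIntegral_congr Iio_ae_eq_Iic.symm
  rw [h1, ← lintegral_indicator measurableSet_Iio, ← lintegral_indicator measurableSet_Ioi,
    ← lintegral_sub_left_eq_self _ (2 * c)]
  congr 1
  ext x
  simp only [Set.indicator, Set.mem_Iio, Set.mem_Ioi, hs]
  congr 1
  simp only [eq_iff_iff]
  constructor <;> intro h <;> linarith

lemma setLIntegral_Ioi_modelDensity (hDK : 0 < K / (N - 1) → D ≤ Real.pi / √(K / (N - 1)))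
    (F : ℝ → ℝ≥0∞) :
    ∫⁻ x in Set.Ioi (D / 2), ENNReal.ofReal (modelDensity K N D x) * F x
      = ∫⁻ x in Set.Ioo (D / 2) D, ENNReal.ofReal (modelDensity K N D x) * F x := by
  rw [← setLIntegral_congr (μ := volume) Ioo_ae_eq_Ioc.symm, ← lintegral_indicator measurableSet_Ioi,
    ← lintegral_indicator measurableSet_Ioc]
  congr 1
  ext x
  by_cases h1 : D / 2 < x
  · by_cases h2 : x ≤ D
    · simp [Set.indicator, h1, h2]
    · have : modelDensity K N D x = 0 := by
        rw [modelDensity_eq_indicator hDK]; simp [Set.indicator, h2]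
      simp [Set.indicator, h1, h2, this]
  · simp [Set.indicator, h1]

/-- The spectral gap of the model controls functions on its right half that vanish at the
midpoint. -/
lemma poincareConst_mul_le_of_eq_zero (hN : 1 < N)
    (hDK : 0 < K / (N - 1) → D ≤ Real.pi / √(K / (N - 1)))
    (hg : LocallyLipschitz g) (hc : g (D / 2) = 0) :
    poincareConst (modelDensity K N D) *
        ∫⁻ x in Set.Ioo (D / 2) D, ENNReal.ofReal (modelDensity K N D x) * ENNReal.ofReal (g x ^ 2)
      ≤ ∫⁻ x in Set.Ioo (D / 2) D,
          ENNReal.ofReal (modelDensity K N D x) * ENNReal.ofReal (deriv g x ^ 2) := by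
  set m := modelDensity K N D with hm
  -- Oddness against the symmetric weight gives mean zero, and both integrals of `G` are twice those
  -- over the right half, so the factor 2 cancels.
  set G := oddExtension (D / 2) g with hG
  have hmm : Measurable m := measurable_modelDensity hN hDK
  have hGl : LocallyLipschitz G := hg.oddExtension
  have hGm : Measurable G := hGl.continuous.measurable
  have hms : ∀ x, m (2 * (D / 2) - x) = m x := by
    intro x; rw [show 2 * (D / 2) - x = D - x by ring]; exact modelDensity_symm hDK x
  have hGs := fun x => oddExtension_symm (c := D / 2) (g := g) x
  have e1 : ∫⁻ x, ENNReal.ofReal (G x ^ 2) ∂(densityMeasure m)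
      = 2 * ∫⁻ x in Set.Ioo (D / 2) D, ENNReal.ofReal (m x) * ENNReal.ofReal (g x ^ 2) := by
    rw [lintegral_densityMeasure hmm.aemeasurable (by fun_prop),
      lintegral_eq_two_mul_of_symm (c := D / 2),
      setLIntegral_Ioi_modelDensity hDK]
    · congr 1
      refine setLIntegral_congr_fun measurableSet_Ioo fun x hx => ?_
      simp only [hG, oddExtension_of_lt hc hx.1, hm]
    · intro x; rw [hms, hG, hGs, neg_sq]
  have e2 : ∫⁻ x, ENNReal.ofReal (deriv G x ^ 2) ∂(densityMeasure m)
      = 2 * ∫⁻ x in Set.Ioo (D / 2) D,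
          ENNReal.ofReal (m x) * ENNReal.ofReal (deriv g x ^ 2) := by
    have := measurable_deriv G
    rw [lintegral_densityMeasure hmm.aemeasurable (by fun_prop),
      lintegral_eq_two_mul_of_symm (c := D / 2),
      setLIntegral_Ioi_modelDensity hDK]
    · congr 1
      refine setLIntegral_congr_fun measurableSet_Ioo fun x hx => ?_
      simp only [hG, deriv_oddExtension_of_lt hc hx.1, hm]
    · intro x; rw [hms, hG, deriv_oddExtension_symm]
  set A := ∫⁻ x in Set.Ioo (D / 2) D, ENNReal.ofReal (m x) * ENNReal.ofReal (g x ^ 2)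
  set B := ∫⁻ x in Set.Ioo (D / 2) D, ENNReal.ofReal (m x) * ENNReal.ofReal (deriv g x ^ 2)
  -- If `A = 0` then `G` is not admissible, but the left side is zero even when the Poincaré
  -- constant is `∞`.
  rcases eq_or_ne A 0 with hA | hA
  · simp [hA]
  have hint : ∀ f : ℝ → ℝ, Continuous f → Integrable f (densityMeasure m) := by
    intro f hf
    rw [densityMeasure, integrable_withDensity_iff_integrable_smul' hmm.ennreal_ofReal (by simp)]
    simp only [ENNReal.toReal_ofReal (modelDensity_nonneg hDK _), smul_eq_mul, hm]
    exact integrable_mul_modelDensity hN hDK hf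
  have hG2 : ∫⁻ x, ENNReal.ofReal (G x ^ 2) ∂(densityMeasure m) < ∞ := by
    rw [← ofReal_integral_eq_lintegral_ofReal (hint (fun x => G x ^ 2) (hGl.continuous.pow 2))
      (Filter.Eventually.of_forall fun x => sq_nonneg _)]
    exact ENNReal.ofReal_lt_top
  have htest : IsPoincareTest m G :=
    { locallyLipschitz := hGl
      integrable := hint _ hGl.continuous
      mean_zero := by
        rw [densityMeasure, integral_withDensity_eq_integral_toReal_smul hmm.ennreal_ofReal
          (by simp)]
        simp only [hm, ENNReal.toReal_ofReal (modelDensity_nonneg hDK _), smul_eq_mul]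
        rw [← hm]
        have h := integral_sub_left_eq_self (fun x => m x * G x) volume (2 * (D / 2))
        have hodd : ∀ x, m (2 * (D / 2) - x) * G (2 * (D / 2) - x) = -(m x * G x) := by
          intro x; rw [hms, hG, hGs, mul_neg]
        simp only [hodd, integral_neg] at h
        linarith
      sq_pos := by
        rw [e1]
        exact ENNReal.mul_pos two_ne_zero hA
      sq_lt_top := hG2 }
  have hle : poincareConst m ≤ _ := iInf₂_le G htest
  rw [ENNReal.le_div_iff_mul_le (Or.inl htest.sq_pos.ne') (Or.inl htest.sq_lt_top.ne), e1, e2,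
    mul_left_comm] at hle
  exact (ENNReal.mul_le_mul_iff_right two_ne_zero ENNReal.ofNat_ne_top).1 hle

end HalfInequality

/-! ### Transfer to densities monotone relative to the model. -/

section LayerCake

variable {K N D : ℝ} {g h : ℝ → ℝ}

/-- The half inequality localises to initial segments, by stopping the test function. -/
lemma poincareConst_mul_le_of_eq_zero_of_le (hN : 1 < N)
    (hDK : 0 < K / (N - 1) → D ≤ Real.pi / √(K / (N - 1)))
    (hg : LocallyLipschitz g) (hc : g (D / 2) = 0) {t : ℝ} (ht : D / 2 ≤ t) (htD : t ≤ D) :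
    poincareConst (modelDensity K N D) *
        ∫⁻ x in Set.Ioo (D / 2) t, ENNReal.ofReal (modelDensity K N D x) * ENNReal.ofReal (g x ^ 2)
      ≤ ∫⁻ x in Set.Ioo (D / 2) t,
          ENNReal.ofReal (modelDensity K N D x) * ENNReal.ofReal (deriv g x ^ 2) := by
  -- Freezing `g` beyond `t` removes the energy on `(t, D)`, while the mass there is nonnegative and
  -- can be dropped.
  set gt : ℝ → ℝ := fun x => g (min x t) with hgt
  have hgtl : LocallyLipschitz gt := hg.comp (LocallyLipschitz.id.min_const t)
  have hgt1 : ∀ x < t, gt x = g x := fun x hx => by simp [hgt, hx.le]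
  have hgt2 : ∀ x < t, deriv gt x = deriv g x := fun x hx => by
    apply Filter.EventuallyEq.deriv_eq
    filter_upwards [gt_mem_nhds hx] with y hy using hgt1 y hy
  have hgt3 : ∀ x > t, deriv gt x = 0 := fun x hx => by
    have : gt =ᶠ[nhds x] fun _ => g t := by
      filter_upwards [lt_mem_nhds hx] with y hy
      simp [hgt, hy.le]
    rw [this.deriv_eq, deriv_const]
  have hsub : Set.Ioo (D / 2) t ⊆ Set.Ioo (D / 2) D := Set.Ioo_subset_Ioo_right htD
  have key := poincareConst_mul_le_of_eq_zero hN hDK hgtl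
    (by rw [hgt]; simp [min_eq_left ht, hc])
  calc _ ≤ poincareConst (modelDensity K N D) * ∫⁻ x in Set.Ioo (D / 2) D,
          ENNReal.ofReal (modelDensity K N D x) * ENNReal.ofReal (gt x ^ 2) := by
        gcongr 1
        refine le_of_eq_of_le (setLIntegral_congr_fun measurableSet_Ioo fun x hx => ?_)
          (lintegral_mono_set hsub)
        simp only [hgt1 x hx.2]
    _ ≤ _ := key
    _ = _ := by
        rw [← lintegral_indicator measurableSet_Ioo, ← lintegral_indicator measurableSet_Ioo]
        apply lintegral_congr_ae
        filter_upwards [Measure.ae_ne volume t] with x hx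
        rcases hx.lt_or_gt with hx | hx
        · simp only [Set.indicator, Set.mem_Ioo, hx, hgt2 x hx, hx.trans_le htD]
        · simp [Set.indicator, hgt3 x hx, hx.not_gt]

/-- A superlevel set of an antitone function is an initial segment; only its end point is
undetermined, and that is a null set. -/
lemma ae_mem_superlevel_iff_of_antitoneOn {ρ : ℝ → ℝ} {a b : ℝ} (hab : a ≤ b)
    (hρ : AntitoneOn ρ (Set.Ioo a b)) (s : ℝ) :
    ∃ t ∈ Set.Icc a b,
      {x | s < ρ x} =ᵐ[volume.restrict (Set.Ioo a b)] Set.Iio t := by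
  -- Inserting `a` keeps the set nonempty, so an empty superlevel set yields `t = a`.
  set S := insert a (Set.Ioo a b ∩ {x | s < ρ x})
  have hS : BddAbove S := ⟨b, by rintro x (rfl | hx); exacts [hab, hx.1.2.le]⟩
  refine ⟨sSup S, ⟨le_csSup hS (Set.mem_insert _ _), csSup_le ⟨a, Set.mem_insert _ _⟩ ?_⟩, ?_⟩
  · rintro x (rfl | hx); exacts [hab, hx.1.2.le]
  · filter_upwards [ae_restrict_mem measurableSet_Ioo,
      ae_restrict_of_ae (Measure.ae_ne volume (sSup S))] with x hx hne
    apply propext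
    change s < ρ x ↔ x < sSup S
    constructor
    · intro h
      exact lt_of_le_of_ne (le_csSup hS (Or.inr ⟨hx, h⟩)) hne
    · intro h
      obtain ⟨y, (rfl | hy), hxy⟩ := exists_lt_of_lt_csSup ⟨a, Set.mem_insert _ _⟩ h
      · exact absurd hxy hx.1.not_gt
      · exact lt_of_lt_of_le hy.2 (hρ hx hy.1 hxy.le)

/-- Comparison of the half inequalities for densities that are nonincreasing relative to
the model. -/
lemma poincareConst_mul_le_of_relative_antitone (hN : 1 < N) (hD : 0 < D)
    (hDK : 0 < K / (N - 1) → D ≤ Real.pi / √(K / (N - 1))) (hh : ∀ x, 0 ≤ h x)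
    (hanti : ∀ y x, D / 2 < y → y ≤ x → x < D →
      sFun (K / (N - 1)) y ^ (N - 1) * h x ≤ h y * sFun (K / (N - 1)) x ^ (N - 1))
    (hg : LocallyLipschitz g) (hc : g (D / 2) = 0) :
    poincareConst (modelDensity K N D) *
        ∫⁻ x in Set.Ioo (D / 2) D, ENNReal.ofReal (h x) * ENNReal.ofReal (g x ^ 2)
      ≤ ∫⁻ x in Set.Ioo (D / 2) D, ENNReal.ofReal (h x) * ENNReal.ofReal (deriv g x ^ 2) := by
  set m := modelDensity K N D with hm
  set ρ : ℝ → ℝ := fun x => h x / m x with hρdef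
  have hmm : Measurable m := measurable_modelDensity hN hDK
  have hmpos : ∀ x ∈ Set.Ioo (D / 2) D, 0 < m x := fun x hx =>
    modelDensity_pos hDK ⟨by linarith [hx.1], hx.2⟩
  have hρ : AntitoneOn ρ (Set.Ioo (D / 2) D) := by
    intro y hy x hx hyx
    rw [hρdef]
    have := hanti y x hy.1 hyx hx.2
    rw [← modelDensity_of_mem_Ioo hy, ← modelDensity_of_mem_Ioo hx, ← hm] at this
    simp only
    rw [div_le_div_iff₀ (hmpos x hx) (hmpos y hy)]
    linarith
  have hρ0 : ∀ x, 0 ≤ ρ x := fun x => div_nonneg (hh x) (modelDensity_nonneg hDK x)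
  have hρm : AEMeasurable ρ (volume.restrict (Set.Ioo (D / 2) D)) :=
    aemeasurable_restrict_of_antitoneOn measurableSet_Ioo hρ
  -- Layer cake for `h = m * ρ`: integrate over `s > 0` the mass that `m F` gives to `{ρ > s}`.
  have cake : ∀ F : ℝ → ℝ, Measurable F →
      ∫⁻ x in Set.Ioo (D / 2) D, ENNReal.ofReal (h x) * ENNReal.ofReal (F x)
        = ∫⁻ s in Set.Ioi (0 : ℝ), ((volume.restrict (Set.Ioo (D / 2) D)).withDensity
            fun x => ENNReal.ofReal (m x) * ENNReal.ofReal (F x)) {x | s < ρ x} := by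
    intro F hF
    rw [← lintegral_eq_lintegral_meas_lt _ (Filter.Eventually.of_forall hρ0)
      (hρm.mono_ac (withDensity_absolutelyContinuous _ _)),
      lintegral_withDensity_eq_lintegral_mul₀ (by fun_prop) hρm.ennreal_ofReal]
    refine setLIntegral_congr_fun measurableSet_Ioo fun x hx => ?_
    have : h x = m x * ρ x := (mul_div_cancel₀ _ (hmpos x hx).ne').symm
    simp only [Pi.mul_apply]
    rw [this, ENNReal.ofReal_mul (hmpos x hx).le, mul_right_comm]
  have hgm : Measurable g := hg.continuous.measurable
  rw [cake (fun x => g x ^ 2) (by fun_prop),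
    cake (fun x => deriv g x ^ 2) ((measurable_deriv g).pow_const 2)]
  refine (lintegral_const_mul_le _ _).trans (lintegral_mono fun s => ?_)
  obtain ⟨t, ht, hst⟩ := ae_mem_superlevel_iff_of_antitoneOn (by linarith) hρ s
  rw [measure_congr ((withDensity_absolutelyContinuous _ _).ae_le hst),
    measure_congr ((withDensity_absolutelyContinuous _ _).ae_le hst),
    withDensity_apply _ measurableSet_Iio, withDensity_apply _ measurableSet_Iio,
    Measure.restrict_restrict measurableSet_Iio]
  have : Set.Iio t ∩ Set.Ioo (D / 2) D = Set.Ioo (D / 2) t := by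
    ext x
    simp only [Set.mem_inter_iff, Set.mem_Iio, Set.mem_Ioo]
    exact ⟨fun h => ⟨h.2.1, h.1⟩, fun h => ⟨h.2, h.1, h.2.trans_le ht.2⟩⟩
  rw [this]
  exact poincareConst_mul_le_of_eq_zero_of_le hN hDK hg hc ht.1 ht.2

end LayerCake

/-! ### Consequences of the MCP inequality: interval support and diameter bound. -/

section MCP

variable {K N D : ℝ} {h : ℝ → ℝ}

lemma IsMCPDensity.aemeasurable (hh : IsMCPDensity K N h) : AEMeasurable h :=
  hh.locallyIntegrable.aestronglyMeasurable.aemeasurable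

/-- The density may vanish at a given support point, such as an endpoint. Since the measure is
carried by its support, nearby support points of positive density replace it. -/
lemma exists_pos_of_mem_densitySupport (hm : AEMeasurable h) {x : ℝ}
    (hx : x ∈ densitySupport h) {U : Set ℝ} (hU : U ∈ nhds x) :
    ∃ y ∈ U ∩ densitySupport h, 0 < h y := by
  by_contra! hcon
  have hpos := (Measure.mem_support_iff_forall x).1 hx U hU
  refine hpos.ne' ?_
  have h0 : densityMeasure h (U ∩ densitySupport h) = 0 := by
    rw [densityMeasure, withDensity_apply_eq_zero' (by fun_prop)]
    convert measure_empty (μ := volume)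
    ext y
    simp only [Set.mem_inter_iff, Set.mem_ofPred_eq, Set.mem_empty_iff_false, iff_false]
    rintro ⟨h1, h2⟩
    exact h1 (ENNReal.ofReal_eq_zero.2 (hcon y h2))
  rwa [densitySupport, measure_inter_conull Measure.measure_compl_support] at h0

/-- Points of positive density are at distance less than the Bonnet-Myers bound from every other
point of the support. -/
lemma IsMCPDensity.dist_lt (hN : 1 < N) (hh : IsMCPDensity K N h) {x₀ x₁ : ℝ}
    (h₀ : x₀ ∈ densitySupport h) (h₁ : x₁ ∈ densitySupport h) (hpos : 0 < h x₀)
    (hK : 0 < K / (N - 1)) : |x₁ - x₀| < Real.pi / √(K / (N - 1)) := by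
  by_contra! hcon
  have := hh.contraction x₀ h₀ x₁ h₁ 0 (by simp)
  rw [sigmaCoeff, if_pos ((bonnetMyers_le_ofReal_iff hN (abs_nonneg _)).2 ⟨hK, hcon⟩),
    ENNReal.top_rpow_of_pos (by linarith),
    ENNReal.top_mul (by simpa using hpos)] at this
  exact ENNReal.ofReal_ne_top (top_le_iff.1 this)

lemma IsMCPDensity.mul_rpow_le (hN : 1 < N) (hh : IsMCPDensity K N h) {x₀ x₁ t : ℝ}
    (h₀ : x₀ ∈ densitySupport h) (h₁ : x₁ ∈ densitySupport h) (hne : x₁ ≠ x₀)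
    (hlt : 0 < K / (N - 1) → |x₁ - x₀| < Real.pi / √(K / (N - 1)))
    (ht : t ∈ Set.Icc (0 : ℝ) 1) :
    sFun (K / (N - 1)) ((1 - t) * |x₁ - x₀|) ^ (N - 1) * h x₀
      ≤ h (t * x₁ + (1 - t) * x₀) * sFun (K / (N - 1)) |x₁ - x₀| ^ (N - 1) := by
  have hθ : 0 < |x₁ - x₀| := abs_pos.2 (sub_ne_zero.2 hne)
  have := hh.contraction x₀ h₀ x₁ h₁ t ht
  have hs := sFun_pos hθ hlt
  have hnum : 0 ≤ sFun (K / (N - 1)) ((1 - t) * |x₁ - x₀|) :=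
    sFun_nonneg (mul_nonneg (by linarith [ht.2]) hθ.le) fun hκ => by nlinarith [ht.1, hlt hκ]
  rw [sigmaCoeff, if_neg, if_neg hθ.ne', ENNReal.ofReal_rpow_of_nonneg
    (div_nonneg hnum hs.le) (by linarith), ← ENNReal.ofReal_mul (by positivity),
    ENNReal.ofReal_le_ofReal_iff (hh.nonneg _), Real.div_rpow hnum hs.le,
    div_mul_eq_mul_div, div_le_iff₀ (by positivity)] at this
  · exact this
  · rw [bonnetMyers_le_ofReal_iff hN (abs_nonneg _)]
    rintro ⟨h1, h2⟩
    exact (hlt h1).not_ge h2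

/-- Form of `IsMCPDensity.mul_rpow_le` with the intermediate point given explicitly, to the right
of the centre of contraction. -/
lemma IsMCPDensity.mul_rpow_le_of_left (hN : 1 < N) (hh : IsMCPDensity K N h) {a y x : ℝ}
    (ha : a ∈ densitySupport h) (hx : x ∈ densitySupport h) (hay : a < y) (hyx : y ≤ x)
    (hlt : 0 < K / (N - 1) → x - a < Real.pi / √(K / (N - 1))) :
    sFun (K / (N - 1)) (y - a) ^ (N - 1) * h x
      ≤ h y * sFun (K / (N - 1)) (x - a) ^ (N - 1) := by
  have hax : 0 < x - a := by linarith
  have habs : |a - x| = x - a := by rw [abs_sub_comm, abs_of_pos hax]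
  -- Contract from `x` towards `a`; this `t` solves `t * a + (1 - t) * x = y`.
  have := hh.mul_rpow_le hN hx ha (by linarith) (by rwa [habs]) (t := (x - y) / (x - a))
    ⟨div_nonneg (by linarith) hax.le, (div_le_one hax).2 (by linarith)⟩
  rw [habs] at this
  convert this using 5
  · field_simp; ring
  · field_simp; ring

/-- Form of `IsMCPDensity.mul_rpow_le` with the intermediate point given explicitly, to the left
of the centre of contraction. -/
lemma IsMCPDensity.mul_rpow_le_of_right (hN : 1 < N) (hh : IsMCPDensity K N h) {b y x : ℝ}
    (hb : b ∈ densitySupport h) (hx : x ∈ densitySupport h) (hyb : y < b) (hxy : x ≤ y)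
    (hlt : 0 < K / (N - 1) → b - x < Real.pi / √(K / (N - 1))) :
    sFun (K / (N - 1)) (b - y) ^ (N - 1) * h x
      ≤ h y * sFun (K / (N - 1)) (b - x) ^ (N - 1) := by
  have hax : 0 < b - x := by linarith
  have habs : |b - x| = b - x := abs_of_pos hax
  have := hh.mul_rpow_le hN hx hb (by linarith) (by rwa [habs]) (t := (y - x) / (b - x))
    ⟨div_nonneg (by linarith) hax.le, (div_le_one hax).2 (by linarith)⟩
  rw [habs] at this
  convert this using 5
  · field_simp; ring
  · field_simp; ring

/-- The support of an MCP density of finite diameter is an interval. -/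
lemma IsMCPDensity.exists_densitySupport_eq_Icc (hN : 1 < N) (hD : 0 < D)
    (hh : IsMCPDensity K N h) (hdiam : Metric.ediam (densitySupport h) = ENNReal.ofReal D) :
    ∃ a, densitySupport h = Set.Icc a (a + D) := by
  set S := densitySupport h with hS
  have hSc : IsClosed S := Measure.isClosed_support
  have hb : Bornology.IsBounded S := by
    rw [Metric.isBounded_iff_ediam_ne_top, hdiam]; exact ENNReal.ofReal_ne_top
  have hne : S.Nonempty := by
    rw [Set.nonempty_iff_ne_empty]
    intro h0
    rw [h0, Metric.ediam_empty] at hdiam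
    exact (ENNReal.ofReal_pos.2 hD).ne hdiam
  have hdiam' : sSup S - sInf S = D := by
    rw [← Real.diam_eq hb, Metric.diam, hdiam, ENNReal.toReal_ofReal hD.le]
  have ha : sInf S ∈ S := hSc.csInf_mem hne hb.bddBelow
  have hbm : sSup S ∈ S := hSc.csSup_mem hne hb.bddAbove
  refine ⟨sInf S, ?_⟩
  rw [show sInf S + D = sSup S by linarith]
  refine Set.Subset.antisymm (subset_Icc_csInf_csSup hb.bddBelow hb.bddAbove) ?_
  rw [← closure_Ioo (by linarith : sInf S < sSup S).ne, hSc.closure_subset_iff]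
  intro y hy
  -- Contracting a point `x > y` of positive density towards the left endpoint makes `h` positive on
  -- all of `(sInf S, x)`, which contains `y`.
  obtain ⟨x, ⟨hyx, hxS⟩, hxpos⟩ :=
    exists_pos_of_mem_densitySupport hh.aemeasurable hbm (lt_mem_nhds hy.2)
  change y < x at hyx
  have hax : sInf S < x := hy.1.trans hyx
  have hlt : 0 < K / (N - 1) → x - sInf S < Real.pi / √(K / (N - 1)) := fun hK => by
    have := hh.dist_lt hN hxS ha hxpos hK
    rwa [abs_sub_comm, abs_of_pos (by linarith)] at this
  refine Icc_subset_densitySupport hh.aemeasurable hax (fun z hz => ?_) ⟨hy.1.le, hyx.le⟩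
  have h1 := hh.mul_rpow_le_of_left hN ha hxS hz.1 hz.2.le hlt
  have h2 : 0 < sFun (K / (N - 1)) (z - sInf S) ^ (N - 1) * h x :=
    mul_pos (Real.rpow_pos_of_pos (sFun_pos (by linarith [hz.1])
      fun hK => by linarith [hlt hK, hz.2]) _) hxpos
  have h3 : 0 < sFun (K / (N - 1)) (x - sInf S) ^ (N - 1) :=
    Real.rpow_pos_of_pos (sFun_pos (by linarith) hlt) _
  exact pos_of_mul_pos_left (h2.trans_le h1) h3.le

/-- If `D` were larger, a point of positive density near the right end would lie beyond the
Bonnet-Myers distance from `a`, contradicting `IsMCPDensity.dist_lt`. -/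
lemma IsMCPDensity.diam_le (hN : 1 < N) (hD : 0 < D) (hh : IsMCPDensity K N h) {a : ℝ}
    (hS : densitySupport h = Set.Icc a (a + D)) (hK : 0 < K / (N - 1)) :
    D ≤ Real.pi / √(K / (N - 1)) := by
  by_contra! hcon
  have hb : a + D ∈ densitySupport h := by rw [hS]; exact ⟨by linarith, le_rfl⟩
  have ha : a ∈ densitySupport h := by rw [hS]; exact ⟨le_rfl, by linarith⟩
  obtain ⟨x, ⟨hx, hxS⟩, hpos⟩ := exists_pos_of_mem_densitySupport hh.aemeasurable hb
    (lt_mem_nhds (show a + Real.pi / √(K / (N - 1)) < a + D by linarith))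
  have := hh.dist_lt hN hxS ha hpos hK
  rw [abs_lt] at this
  change a + Real.pi / √(K / (N - 1)) < x at hx
  linarith [this.1]

end MCP

/-! ### Gluing the two halves. -/

section Comparison

variable {K N D : ℝ} {h f : ℝ → ℝ}

lemma setLIntegral_Ioo_const_add (F : ℝ → ℝ≥0∞) (a u v : ℝ) :
    ∫⁻ x in Set.Ioo u v, F (a + x) = ∫⁻ x in Set.Ioo (a + u) (a + v), F x := by
  rw [← lintegral_indicator measurableSet_Ioo, ← lintegral_indicator measurableSet_Ioo,
    ← lintegral_add_left_eq_self ((Set.Ioo (a + u) (a + v)).indicator _) a]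
  simp [Set.indicator]

lemma setLIntegral_Ioo_const_sub (F : ℝ → ℝ≥0∞) (b u v : ℝ) :
    ∫⁻ x in Set.Ioo u v, F (b - x) = ∫⁻ x in Set.Ioo (b - v) (b - u), F x := by
  rw [← lintegral_indicator measurableSet_Ioo, ← lintegral_indicator measurableSet_Ioo,
    ← lintegral_sub_left_eq_self ((Set.Ioo (b - v) (b - u)).indicator _) b]
  simp [Set.indicator, and_comm]

lemma setLIntegral_Ioo_add_adjacent (F : ℝ → ℝ≥0∞) {a c b : ℝ} (hac : a ≤ c) (hcb : c ≤ b) :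
    (∫⁻ x in Set.Ioo a c, F x) + ∫⁻ x in Set.Ioo c b, F x = ∫⁻ x in Set.Ioo a b, F x := by
  rw [setLIntegral_congr (μ := volume) (Ioo_ae_eq_Ioc (a := a) (b := c)),
    setLIntegral_congr (μ := volume) (Ioo_ae_eq_Ioc (a := c) (b := b)),
    setLIntegral_congr (μ := volume) (Ioo_ae_eq_Ioc (a := a) (b := b)),
    ← Set.Ioc_union_Ioc_eq_Ioc hac hcb,
    lintegral_union measurableSet_Ioc (Set.Ioc_disjoint_Ioc_of_le le_rfl)]

/-- The integral against the density measure only sees the interior of the support interval. -/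
lemma lintegral_densityMeasure_eq_setLIntegral (hm : AEMeasurable h) {a b : ℝ}
    (hS : densitySupport h = Set.Icc a b) {F : ℝ → ℝ≥0∞} (hF : Measurable F) :
    ∫⁻ x, F x ∂(densityMeasure h) = ∫⁻ x in Set.Ioo a b, ENNReal.ofReal (h x) * F x := by
  have h0 : ∀ᵐ x, x ∉ Set.Icc a b → ENNReal.ofReal (h x) = 0 := by
    have := Measure.measure_compl_support (μ := densityMeasure h)
    rw [← densitySupport, hS, densityMeasure, withDensity_apply_eq_zero' (by fun_prop)] at this
    filter_upwards [compl_mem_ae_iff.2 this] with x hx hxS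
    by_contra hne
    exact hx ⟨hne, hxS⟩
  rw [lintegral_densityMeasure hm hF, setLIntegral_congr (μ := volume) Ioo_ae_eq_Icc,
    ← lintegral_indicator measurableSet_Icc]
  apply lintegral_congr_ae
  filter_upwards [h0] with x hx
  by_cases hxS : x ∈ Set.Icc a b
  · simp only [Set.indicator_of_mem hxS]
  · simp only [Set.indicator_of_notMem hxS, hx hxS, zero_mul]

lemma isFiniteMeasure_densityMeasure (hl : LocallyIntegrable h) {a b : ℝ}
    (hS : densitySupport h = Set.Icc a b) : IsFiniteMeasure (densityMeasure h) := by
  refine ⟨?_⟩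
  have hm : AEMeasurable h := hl.aestronglyMeasurable.aemeasurable
  have := lintegral_densityMeasure_eq_setLIntegral hm hS (F := fun _ => 1) measurable_const
  simp only [lintegral_one, mul_one] at this
  rw [this]
  exact (((hl.integrableOn_isCompact isCompact_Icc).mono_set
    Set.Ioo_subset_Icc_self).lintegral_lt_top)

/-- For a function of mean zero, subtracting a constant does not decrease the second moment. -/
lemma IsPoincareTest.lintegral_sq_le [IsFiniteMeasure (densityMeasure h)]
    (hf : IsPoincareTest h f) (k : ℝ) :
    ∫⁻ x, ENNReal.ofReal (f x ^ 2) ∂(densityMeasure h)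
      ≤ ∫⁻ x, ENNReal.ofReal ((f x - k) ^ 2) ∂(densityMeasure h) := by
  have hfm : Measurable f := hf.locallyLipschitz.continuous.measurable
  have hsq : Integrable (fun x => f x ^ 2) (densityMeasure h) := by
    refine ⟨(hfm.pow_const 2).aestronglyMeasurable, ?_⟩
    rw [hasFiniteIntegral_iff_ofReal (Filter.Eventually.of_forall fun x => sq_nonneg (f x))]
    exact hf.sq_lt_top
  have hlin : Integrable (fun x => 2 * k * f x) (densityMeasure h) := hf.integrable.const_mul _
  have hdiff : Integrable (fun x => f x ^ 2 - 2 * k * f x) (densityMeasure h) := hsq.sub hlin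
  have hc : Integrable (fun _ : ℝ => k ^ 2) (densityMeasure h) := integrable_const _
  have hexp : ∀ x, (f x - k) ^ 2 = f x ^ 2 - 2 * k * f x + k ^ 2 := fun x => by ring
  have hint : Integrable (fun x => (f x - k) ^ 2) (densityMeasure h) := by
    simp only [hexp]; exact hdiff.add hc
  have hval : ∫ x, (f x - k) ^ 2 ∂(densityMeasure h)
      = ∫ x, f x ^ 2 ∂(densityMeasure h) + (densityMeasure h).real Set.univ * k ^ 2 := by
    simp only [hexp]
    rw [integral_add hdiff hc, integral_sub hsq hlin, integral_const_mul,
      hf.mean_zero, integral_const, smul_eq_mul, mul_zero, sub_zero]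
  rw [← ofReal_integral_eq_lintegral_ofReal hsq
      (Filter.Eventually.of_forall fun x => sq_nonneg (f x)),
    ← ofReal_integral_eq_lintegral_ofReal hint
      (Filter.Eventually.of_forall fun x => sq_nonneg (f x - k)), hval]
  refine ENNReal.ofReal_le_ofReal (le_add_of_nonneg_right ?_)
  exact mul_nonneg measureReal_nonneg (sq_nonneg k)

lemma IsMCPDensity.poincareConst_modelDensity_le (hN : 1 < N) (hD : 0 < D)
    (hh : IsMCPDensity K N h) {a : ℝ} (hS : densitySupport h = Set.Icc a (a + D)) :
    poincareConst (modelDensity K N D) ≤ poincareConst h := by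
  have hDK : 0 < K / (N - 1) → D ≤ Real.pi / √(K / (N - 1)) := hh.diam_le hN hD hS
  have hm := hh.aemeasurable
  have := isFiniteMeasure_densityMeasure hh.locallyIntegrable hS
  have ha : a ∈ densitySupport h := by rw [hS]; exact ⟨le_rfl, by linarith⟩
  have hb : a + D ∈ densitySupport h := by rw [hS]; exact ⟨by linarith, le_rfl⟩
  refine le_iInf₂ fun f hf => ?_
  rw [ENNReal.le_div_iff_mul_le (Or.inl hf.sq_pos.ne') (Or.inl hf.sq_lt_top.ne)]
  have hfl := hf.locallyLipschitz
  have hfm : Measurable f := hfl.continuous.measurable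
  -- Subtracting the midpoint value makes both half-interval inequalities applicable.
  set k := f (a + D / 2) with hk
  -- Contraction towards the left endpoint controls the right half; after reflection, contraction
  -- towards the right endpoint controls the left half.
  have right := poincareConst_mul_le_of_relative_antitone (h := fun x => h (a + x))
    (g := fun x => f (a + x) - k) hN hD hDK (fun x => hh.nonneg _)
    (fun y x hy hyx hx => by
      have := hh.mul_rpow_le_of_left hN ha (y := a + y) (x := a + x)
        (by rw [hS]; constructor <;> linarith) (by linarith) (by linarith)
        fun hκ => by linarith [hDK hκ]
      simpa using this)
    ((hfl.comp ((LocallyLipschitz.const a).add LocallyLipschitz.id)).sub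
      (LocallyLipschitz.const k)) (by simp [hk])
  have left := poincareConst_mul_le_of_relative_antitone (h := fun x => h (a + D - x))
    (g := fun x => f (a + D - x) - k) hN hD hDK (fun x => hh.nonneg _)
    (fun y x hy hyx hx => by
      have := hh.mul_rpow_le_of_right hN hb (y := a + D - y) (x := a + D - x)
        (by rw [hS]; constructor <;> linarith) (by linarith) (by linarith)
        fun hκ => by linarith [hDK hκ]
      simpa using this)
    ((hfl.comp ((LocallyLipschitz.const (a + D)).sub LocallyLipschitz.id)).sub
      (LocallyLipschitz.const k)) (by rw [show a + D - D / 2 = a + D / 2 by ring, sub_self])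
  simp only [deriv_sub_const_fun, deriv_comp_const_add, deriv_comp_const_sub, neg_sq] at right left
  rw [setLIntegral_Ioo_const_add (fun x => ENNReal.ofReal (h x) * ENNReal.ofReal ((f x - k) ^ 2)),
    setLIntegral_Ioo_const_add
      (fun x => ENNReal.ofReal (h x) * ENNReal.ofReal (deriv f x ^ 2))] at right
  rw [setLIntegral_Ioo_const_sub (fun x => ENNReal.ofReal (h x) * ENNReal.ofReal ((f x - k) ^ 2)),
    setLIntegral_Ioo_const_sub
      (fun x => ENNReal.ofReal (h x) * ENNReal.ofReal (deriv f x ^ 2)),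
    show a + D - D / 2 = a + D / 2 by ring, show a + D - D = a by ring] at left
  refine (mul_le_mul_right (hf.lintegral_sq_le k) _).trans ?_
  rw [lintegral_densityMeasure_eq_setLIntegral hm hS (by fun_prop),
    lintegral_densityMeasure_eq_setLIntegral hm hS ((measurable_deriv f).pow_const 2).ennreal_ofReal,
    ← setLIntegral_Ioo_add_adjacent (a := a) (c := a + D / 2) (b := a + D) _ (by linarith) (by linarith),
    ← setLIntegral_Ioo_add_adjacent (a := a) (c := a + D / 2) (b := a + D) _ (by linarith) (by linarith),
    mul_add]
  exact add_le_add left right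

end Comparison

/-- The spectral-gap comparison for `MCP(K, N)` densities whose support has diameter exactly `D`
(which forces `D ≤ D_{K,N}`), and its sharpness: whenever `D ≤ D_{K,N}`, the model density
is itself such a density, so that the lower bound is attained. -/
theorem proposition4p6 (K N D : ℝ) (hN : 1 < N) (hD : 0 < D) :
    (∀ h : ℝ → ℝ, IsMCPDensity K N h →
      Metric.ediam (densitySupport h) = ENNReal.ofReal D →
        ENNReal.ofReal D ≤ bonnetMyers K N ∧
          poincareConst (modelDensity K N D) ≤ poincareConst h) ∧
    (ENNReal.ofReal D ≤ bonnetMyers K N →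
      IsMCPDensity K N (modelDensity K N D) ∧
        densitySupport (modelDensity K N D) = Set.Icc 0 D) := by
  refine ⟨fun h hh hdiam => ?_, fun hDK => ?_⟩
  · obtain ⟨a, hS⟩ := hh.exists_densitySupport_eq_Icc hN hD hdiam
    exact ⟨(ofReal_le_bonnetMyers_iff hN D).2 (hh.diam_le hN hD hS),
      hh.poincareConst_modelDensity_le hN hD hS⟩
  · have hDK' := (ofReal_le_bonnetMyers_iff hN D).1 hDK
    exact ⟨isMCPDensity_modelDensity hN hD hDK', densitySupport_modelDensity hN hD hDK'⟩
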